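/- Let $\mathbb T=\mathbb R/2\pi\mathbb Z$, with Riemannian distance $d$, normalized Riemannian (Haar) probability measure $\lambda$ and natural derivative $\partial$. For $x,y\in\mathbb T$ with $y\neq x+\pi$, $y\ne x$, let $t\mapsto\gamma(x,y,t)$, $t\in\mathbb R$, be the unit speed geodesic with $\gamma(x,y,0)=x$ that is minimal from $x$ to $y=\gamma(x,y,d(x,y))$; for $y=x+\pi$ (and, as a convention, for $y=x$) take the anti-clockwise unit speed geodesic. Let $p\ge 1$. For a probability measure $\nu$ on $\mathbb T$ put $$U_p(x)=\int d(x,y)^p\,\nu(dy),\qquad \mu_\beta(dx)=\frac{e^{-\beta U_p(x)}\,\lambda(dx)}{\int e^{-\beta U_p}\,d\lambda},$$ and, for $\alpha>0$, $\beta\ge 0$ and $f\in C^2(\mathbb T)$, $$L_{\alpha,\beta}[f](x)=\tfrac12\,\partial^2 f(x)+\frac1\alpha\int \Bigl(f\bigl(\gamma(x,y,\tfrac p2\,\beta\alpha\, d(x,y)^{p-1})\bigr)-f(x)\Bigr)\,\nu(dy).$$ Let $\tilde a(p)=1$ if $p=1$ or $p\ge 3/2$, and $\tilde a(p)=2(p-1)$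 if $p\in(1,3/2)$. **Lemma.** For every $p\ge1$ there is a constant $\tilde\sigma(p)\in(0,1/2)$, and for every $p\geq 1$ and $A>0$ there is a constant $c_3=c_3(p,A)>0$, such that the following holds. Let $a\in(0,1]$ and let $\nu$ be a probability measure on $\mathbb T$ that has a density with respect to $\lambda$, also denoted $\nu$, with $|\nu(y)-\nu(x)|\le A\,d(x,y)^a$ for all $x,y\in\mathbb T$. Then for all $\alpha>0$ and $\beta\ge1$ with $\alpha\beta^2\le\tilde\sigma(p)$ and every $f\in C^2(\mathbb T)$, the function $L_{\alpha,\beta}[f-1](f-1)$ is $\mu_\beta$-integrable and $$\int L_{\alpha,\beta}[f-1]\,(f-1)\,d\mu_\beta\le-\Bigl(\tfrac12-c_3\,\alpha^{\tilde a(p)}\beta^3\Bigr)\int(\partial f)^2\,d\mu_\beta+c_3\,\alpha^{\tilde a(p)}\beta^3\int(f-1)^2\,d\mu_\beta .$$ -/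

import Mathlib

open MeasureTheory

namespace CircleMeans

noncomputable section

instance instFactTwoPiPos : Fact ((0 : ℝ) < 2 * Real.pi) := ⟨Real.two_pi_pos⟩

/-- The circle `ℝ / 2πℤ`; its norm distance `dist` is the Riemannian (arc length) distance. -/
abbrev Torus : Type := AddCircle (2 * Real.pi)

/-- The normalized Riemannian measure `λ`, a probability measure. -/
def lam : Measure Torus := AddCircle.haarAddCircle

/-- The representative of `y - x` in `(-π, π]`. -/
def angle (x y : Torus) : ℝ := (AddCircle.equivIoc (2 * Real.pi) (-Real.pi) (y - x) : ℝ)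

/-- The direction (`+1` anti-clockwise, `-1` clockwise) in which the minimal geodesic from `x` to
`y` starts. At the cut-locus `y = x + π` the anti-clockwise geodesic is chosen (and also for
`y = x`, where the direction is only a convention). -/
def direction (x y : Torus) : ℝ := if 0 ≤ angle x y then 1 else -1

/-- The point reached at time `t` by the unit speed geodesic that starts at `x`, is minimal
from `x` to `y`, and is continued for all times. -/
def geodesic (x y : Torus) (t : ℝ) : Torus := x + ((t * direction x y : ℝ) : Torus)

theorem geodesic_zero (x y : Torus) : geodesic x y 0 = x := by
  simp [geodesic]

theorem geodesic_dist (x y : Torus) : geodesic x y (dist x y) = y := by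
  have hπ := Real.pi_pos
  have hmem := (AddCircle.equivIoc (2 * Real.pi) (-Real.pi) (y - x)).2
  have hcoe : ((angle x y : ℝ) : Torus) = y - x := AddCircle.coe_equivIoc
  have hle : |angle x y| ≤ Real.pi := by
    rw [abs_le]
    constructor
    · exact hmem.1.le
    · have h2 := hmem.2
      unfold angle
      linarith
  have hd : dist x y = |angle x y| := by
    rw [dist_comm, dist_eq_norm, ← hcoe]
    refine (AddCircle.norm_coe_eq_abs_iff (p := 2 * Real.pi) (by positivity)).2 ?_
    rw [abs_of_pos Real.two_pi_pos]
    linarith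
  have hm : dist x y * direction x y = angle x y := by
    rw [hd]
    unfold direction
    split_ifs with h
    · rw [abs_of_nonneg h, mul_one]
    · rw [abs_of_neg (not_le.1 h)]
      ring
  rw [geodesic, hm, hcoe, add_sub_cancel]

/-- The natural derivative `∂` of a function on the circle. -/
def circleDeriv (f : Torus → ℝ) (x : Torus) : ℝ := deriv (fun t : ℝ => f (x + (t : Torus))) 0

/-- `f ∈ C²(𝕋)`: the `2π`-periodic lift of `f` to `ℝ` is `C²`. -/
def IsC2 (f : Torus → ℝ) : Prop := ContDiff ℝ 2 (fun t : ℝ => f (t : Torus))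

/-- The potential `U_p(x) = ∫ d(x,y)^p ν(dy)`. -/
def potential (ν : Measure Torus) (p : ℝ) (x : Torus) : ℝ := ∫ y, dist x y ^ p ∂ν

/-- The Gibbs probability measure `μ_β(dx) = Z⁻¹ exp(-β U_p(x)) λ(dx)`. -/
def gibbs (ν : Measure Torus) (p β : ℝ) : Measure Torus :=
  lam.tilted (fun x => -β * potential ν p x)

/-- The generator `L_{α,β}`. -/
def generator (ν : Measure Torus) (p α β : ℝ) (f : Torus → ℝ) (x : Torus) : ℝ :=
  (1 / 2) * circleDeriv (circleDeriv f) x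
    + (1 / α) * ∫ y, (f (geodesic x y ((p / 2) * β * α * dist x y ^ (p - 1))) - f x) ∂ν

/-- The exponent `ã(p)` (meaningful for `p ≥ 1`). -/
def aTilde (p : ℝ) : ℝ := if p = 1 ∨ 3 / 2 ≤ p then 1 else 2 * (p - 1)

end

end CircleMeans

open CircleMeans

namespace CircleMeans

open Set intervalIntegral

/-! Lift everything to `2π`-periodic functions on the line: `G = f - 1`, `H = G'`, `r` the density,
`V` the potential, `M = exp (-β V)`. From `x`, the points at distance `θ` on side `ε = ±1` are `x +
ε θ`, and the jump is `ε τ(θ)` with `τ(θ) = (p/2) β α θ^(p-1)`. Integrating `(1/2) G''` by parts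
against `G M` gives `-(1/2) ∫ H² M` plus a drift term `(β/2) ∫ V' H G M`. The first-order Taylor
term of the jump part is exactly `-(β/2) V' H`, so the drift cancels and only the Taylor remainder
is left.

The remainder is the integral over `u ∈ [0,1]` of `ε τ (H(x + u ε τ) - H(x)) r(x + ε θ) G M`.
Translating `x` by `u ε τ`, which periodicity permits, moves the difference from `H` onto `r · G M`.
The difference of `G M` costs `τ` times the energy, with a factor of order `β` from the weight
(`abs_integral_mul_shift_weight_le`). The difference of `r` is handled by integrating in `θ` against
an antiderivative of `r`, so only boundedness and continuity of `r` matter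
(`abs_integral_mul_shift_sub_le`). The remainder is thus `O(β τ(π)²)`, hence `O(α β³)` after
division by `α`. This has power `1` of `α` for every `p`; since `α ≤ 1` and `aTilde p ≤ 1`, it
implies the claim. -/

/-! ### Elementary facts on interval integrals. -/

theorem integral_swap_of_continuous {F : ℝ → ℝ → ℝ} (hF : Continuous fun z : ℝ × ℝ => F z.1 z.2)
    (a b c d : ℝ) :
    ∫ x in a..b, ∫ y in c..d, F x y = ∫ y in c..d, ∫ x in a..b, F x y := by
  apply intervalIntegral_intervalIntegral_swap
  exact (hF.continuousOn.integrableOn_compact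
    (isCompact_uIcc.prod isCompact_uIcc)).mono_set
    (Set.prod_mono uIoc_subset_uIcc uIoc_subset_uIcc)

theorem integral_comp_add_of_periodic {f : ℝ → ℝ} {T : ℝ} (hf : Function.Periodic f T) (s : ℝ) :
    ∫ x in (0 : ℝ)..T, f (x + s) = ∫ x in (0 : ℝ)..T, f x := by
  rw [intervalIntegral.integral_comp_add_right, zero_add, add_comm T s, hf.intervalIntegral_add_eq s 0,
    zero_add]

theorem abs_integral_le_integral_of_abs_le {f g : ℝ → ℝ} {a b : ℝ} (hab : a ≤ b)
    (hg : Continuous g) (h : ∀ x, |f x| ≤ g x) :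
    |∫ x in a..b, f x| ≤ ∫ x in a..b, g x := by
  rw [← Real.norm_eq_abs]
  exact intervalIntegral.norm_integral_le_of_norm_le hab (Filter.Eventually.of_forall fun x _ => h x)
    (hg.intervalIntegrable _ _)

/-! ### The Taylor remainder of the jump part. -/

/-- Integration by parts against an antiderivative of `r` bounds the oscillation of `r` along a
monotone displacement `τ`, without any smoothness of `r`. -/
theorem abs_integral_mul_shift_sub_le {r τ τ' : ℝ → ℝ} {B ε u b : ℝ} (hb : 0 ≤ b)
    (hr : Continuous r) (hrB : ∀ x, |r x| ≤ B) (hε : ε = 1 ∨ ε = -1) (hu : 0 ≤ u) (hu1 : u ≤ 1)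
    (hτ : ContinuousOn τ (Icc 0 b)) (hτ0 : 0 ≤ τ 0)
    (hd : ∀ θ ∈ Ioo 0 b, HasDerivAt τ (τ' θ) θ) (hd0 : ∀ θ ∈ Ioo 0 b, 0 ≤ τ' θ) (x : ℝ) :
    |∫ θ in (0 : ℝ)..b, τ θ * (r (x + ε * θ - u * ε * τ θ) - r (x + ε * θ))| ≤ 3 * B * τ b ^ 2 := by
  have hB : 0 ≤ B := (abs_nonneg _).trans (hrB 0)
  have hmono : MonotoneOn τ (Icc 0 b) := by
    refine monotoneOn_of_deriv_nonneg (convex_Icc 0 b) hτ ?_ ?_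
    · rw [interior_Icc]
      exact fun θ hθ => (hd θ hθ).differentiableAt.differentiableWithinAt
    · rw [interior_Icc]
      exact fun θ hθ => (hd θ hθ).deriv ▸ hd0 θ hθ
  have hτnn : ∀ θ ∈ Icc 0 b, 0 ≤ τ θ := fun θ hθ =>
    hτ0.trans (hmono (left_mem_Icc.2 hb) hθ hθ.1)
  have hτle : ∀ θ ∈ Icc 0 b, τ θ ≤ τ b := fun θ hθ => hmono hθ (right_mem_Icc.2 hb) hθ.2
  have hεa : |ε| = 1 := by rcases hε with h | h <;> simp [h]
  set P : ℝ → ℝ := fun t => ∫ s in (0 : ℝ)..t, r s with hP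
  have hPd : ∀ t, HasDerivAt P (r t) t := fun t => hr.integral_hasStrictDerivAt 0 t |>.hasDerivAt
  have hPc : Continuous P := continuous_iff_continuousAt.2 fun t => (hPd t).continuousAt
  have hPL : ∀ s t, |P s - P t| ≤ B * |s - t| := by
    intro s t
    have : P s - P t = ∫ v in t..s, r v :=
      integral_interval_sub_left (hr.intervalIntegrable _ _) (hr.intervalIntegrable _ _)
    rw [this, ← Real.norm_eq_abs]
    exact intervalIntegral.norm_integral_le_of_norm_le_const fun v _ => hrB v
  set Q : ℝ → ℝ := fun θ => P (x + ε * θ - u * ε * τ θ) - P (x + ε * θ) with hQ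
  have hQb : ∀ θ ∈ Icc 0 b, |Q θ| ≤ B * τ θ := by
    intro θ hθ
    refine (hPL _ _).trans (mul_le_mul_of_nonneg_left ?_ hB)
    have : x + ε * θ - u * ε * τ θ - (x + ε * θ) = -(u * ε * τ θ) := by ring
    rw [this, abs_neg, abs_mul, abs_mul, hεa, mul_one, abs_of_nonneg hu,
      abs_of_nonneg (hτnn θ hθ)]
    exact mul_le_of_le_one_left (hτnn θ hθ) hu1
  have hQc : ContinuousOn Q (Icc 0 b) := by
    refine (hPc.comp_continuousOn ?_).sub (hPc.comp_continuousOn ?_) <;> fun_prop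
  have hrc : ContinuousOn (fun θ => r (x + ε * θ - u * ε * τ θ)) (Icc 0 b) :=
    hr.comp_continuousOn (by fun_prop)
  have hrc' : ContinuousOn (fun θ => r (x + ε * θ)) (Icc 0 b) :=
    hr.comp_continuousOn (by fun_prop)
  -- `τ'` may blow up at `0` (for `τ = c θ^(p-1)` with `1 < p < 2`); its integrability comes from
  -- its sign and the continuity of `τ`.
  have hτ'i : IntervalIntegrable τ' volume 0 b := by
    apply intervalIntegrable_deriv_of_nonneg (g := τ) <;>
      simpa only [uIcc_of_le hb, min_eq_left hb, max_eq_right hb]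
  have e1 : IntervalIntegrable (fun θ => τ' θ * Q θ) volume 0 b :=
    hτ'i.mul_continuousOn (by rwa [uIcc_of_le hb])
  have e2 : IntervalIntegrable (fun θ => τ' θ * (u * (τ θ * r (x + ε * θ - u * ε * τ θ))))
      volume 0 b := by
    apply hτ'i.mul_continuousOn
    rw [uIcc_of_le hb]
    fun_prop
  have e3 : IntervalIntegrable
      (fun θ => τ θ * (r (x + ε * θ - u * ε * τ θ) - r (x + ε * θ))) volume 0 b := by
    apply ContinuousOn.intervalIntegrable
    rw [uIcc_of_le hb]
    fun_prop
  have e4 : IntervalIntegrable (fun θ => τ' θ * τ θ) volume 0 b :=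
    hτ'i.mul_continuousOn (by rwa [uIcc_of_le hb])
  -- Differentiating `τ Q` produces the wanted integrand plus two terms carrying `τ'`. As `|Q| ≤ B
  -- τ`, each of these is at most `B τ τ'`, with integral at most `B τ(b)² / 2`; the two boundary
  -- values cost `B τ(b)²` each, whence the constant `3`.
  have hF := integral_eq_sub_of_hasDerivAt_of_le (f := fun θ => τ θ * Q θ)
    (f' := fun θ => τ' θ * Q θ + ε * (τ θ * (r (x + ε * θ - u * ε * τ θ) - r (x + ε * θ)))
      - ε * (τ' θ * (u * (τ θ * r (x + ε * θ - u * ε * τ θ))))) hb (hτ.mul hQc) (by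
      intro θ hθ
      have h1 : HasDerivAt (fun θ => x + ε * θ) ε θ := by
        simpa using ((hasDerivAt_id θ).const_mul ε).const_add x
      have h2 : HasDerivAt (fun θ => x + ε * θ - u * ε * τ θ) (ε - u * ε * τ' θ) θ :=
        h1.sub ((hd θ hθ).const_mul _)
      have h3 := (hd θ hθ).mul (((hPd _).comp θ h2).sub ((hPd _).comp θ h1))
      refine HasDerivAt.congr_deriv h3 ?_
      simp only [hQ, Function.comp_apply, Pi.sub_apply]
      ring) ((e1.add (e3.const_mul ε)).sub (e2.const_mul ε))
  rw [integral_sub (e1.add (e3.const_mul ε)) (e2.const_mul ε), integral_add e1 (e3.const_mul ε),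
    intervalIntegral.integral_const_mul, intervalIntegral.integral_const_mul] at hF
  have hsq := integral_eq_sub_of_hasDerivAt_of_le (f := fun θ => τ θ ^ 2 / 2)
    (f' := fun θ => τ' θ * τ θ) hb (by fun_prop) (by
      intro θ hθ
      refine HasDerivAt.congr_deriv (((hd θ hθ).pow 2).div_const 2) ?_
      push_cast; ring) e4
  have hI1 : |∫ θ in (0 : ℝ)..b, τ' θ * Q θ| ≤ B * (τ b ^ 2 / 2) := by
    rw [← Real.norm_eq_abs]
    refine (norm_integral_le_of_norm_le hb (g := fun θ => B * (τ' θ * τ θ)) ?_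
      (e4.const_mul B)).trans ?_
    · filter_upwards [Measure.ae_ne volume b] with θ hθb hθ
      have hθ' : θ ∈ Ioo 0 b := ⟨hθ.1, lt_of_le_of_ne hθ.2 hθb⟩
      rw [Real.norm_eq_abs, abs_mul, abs_of_nonneg (hd0 θ hθ')]
      nlinarith [hQb θ (Ioo_subset_Icc_self hθ'), hd0 θ hθ']
    · rw [intervalIntegral.integral_const_mul, hsq]
      exact mul_le_mul_of_nonneg_left (by nlinarith) hB
  have hI2 : |∫ θ in (0 : ℝ)..b, τ' θ * (u * (τ θ * r (x + ε * θ - u * ε * τ θ)))|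
      ≤ B * (τ b ^ 2 / 2) := by
    rw [← Real.norm_eq_abs]
    refine (norm_integral_le_of_norm_le hb (g := fun θ => B * (τ' θ * τ θ)) ?_
      (e4.const_mul B)).trans ?_
    · filter_upwards [Measure.ae_ne volume b] with θ hθb hθ
      have hθ' : θ ∈ Ioo 0 b := ⟨hθ.1, lt_of_le_of_ne hθ.2 hθb⟩
      have hn := hτnn θ (Ioo_subset_Icc_self hθ')
      have hr' := hrB (x + ε * θ - u * ε * τ θ)
      rw [Real.norm_eq_abs, abs_mul, abs_mul, abs_mul, abs_of_nonneg (hd0 θ hθ'),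
        abs_of_nonneg hu, abs_of_nonneg hn]
      calc τ' θ * (u * (τ θ * |r (x + ε * θ - u * ε * τ θ)|))
          ≤ τ' θ * (1 * (τ θ * B)) := by have := hd0 θ hθ'; gcongr
        _ = B * (τ' θ * τ θ) := by ring
    · rw [intervalIntegral.integral_const_mul, hsq]
      exact mul_le_mul_of_nonneg_left (by nlinarith) hB
  have hb0 : |τ 0 * Q 0| ≤ B * (τ b ^ 2 / 2) + B * (τ b ^ 2 / 2) := by
    rw [abs_mul, abs_of_nonneg hτ0]
    nlinarith [hQb 0 (left_mem_Icc.2 hb), hτle 0 (left_mem_Icc.2 hb),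
      mul_le_mul_of_nonneg_left (hQb 0 (left_mem_Icc.2 hb)) hτ0,
      mul_le_mul_of_nonneg_left (pow_le_pow_left₀ hτ0 (hτle 0 (left_mem_Icc.2 hb)) 2) hB]
  have hbb : |τ b * Q b| ≤ B * (τ b ^ 2 / 2) + B * (τ b ^ 2 / 2) := by
    have h0 := hτnn b (right_mem_Icc.2 hb)
    rw [abs_mul, abs_of_nonneg h0]
    nlinarith [mul_le_mul_of_nonneg_left (hQb b (right_mem_Icc.2 hb)) h0]
  set I := ∫ θ in (0 : ℝ)..b, τ θ * (r (x + ε * θ - u * ε * τ θ) - r (x + ε * θ))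
  rw [abs_le] at hI1 hI2 hb0 hbb ⊢
  rcases hε with rfl | rfl
  · constructor <;> linarith
  · constructor <;> linarith

/-- The weighted energy of `G` with derivative `H`. -/
noncomputable def energy (G H M : ℝ → ℝ) (T : ℝ) : ℝ :=
  (∫ x in (0 : ℝ)..T, H x ^ 2 * M x) + ∫ x in (0 : ℝ)..T, G x ^ 2 * M x

section Core

variable {G H M : ℝ → ℝ} {T E K S : ℝ}

/-- Split the difference as `(G(x-s) - G(x)) M(x) + G(x-s) (M(x-s) - M(x))`. The first part is an
average of `H` along the segment, the second is governed by the relative Lipschitz constant `K` of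
the weight. `E` compares weights at nearby points, so that after Young's inequality each square
carries the weight at its own point and translation invariance turns everything into the energy. -/
theorem abs_integral_mul_shift_weight_le (hT : 0 ≤ T) (hGH : ∀ x, HasDerivAt G (H x) x)
    (hH : Continuous H) (hM : Continuous M) (hM0 : ∀ x, 0 ≤ M x)
    (hGT : Function.Periodic G T) (hHT : Function.Periodic H T) (hMT : Function.Periodic M T)
    (hE : 0 ≤ E) (hK : 0 ≤ K) (hME : ∀ x y, |x - y| ≤ S → M x ≤ E * M y)
    (hMK : ∀ x y, |x - y| ≤ S → |M x - M y| ≤ K * |x - y| * M x)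
    {q : ℝ → ℝ} {B s : ℝ} (hqB : ∀ x, |q x| ≤ B) (hs : |s| ≤ S) :
    |∫ x in (0 : ℝ)..T, H x * (G (x - s) * M (x - s) - G x * M x) * q x|
      ≤ B * (1 + E) * (1 + K) * |s| * energy G H M T := by
  have hB : 0 ≤ B := (abs_nonneg _).trans (hqB 0)
  have hG : Continuous G := continuous_iff_continuousAt.2 fun t => (hGH t).continuousAt
  have hdiff : ∀ x, |G (x - s) - G x| ≤ |s| * ∫ v in (0 : ℝ)..1, |H (x - v * s)| := by
    intro x
    have h1 : ∫ v in (0 : ℝ)..1, H (x - v * s) * (-s) = G (x - s) - G x := by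
      rw [integral_eq_sub_of_hasDerivAt (f := fun v => G (x - v * s)) (f' := fun v => H (x - v * s) * (-s))]
      · simp
      · intro v _
        have : HasDerivAt (fun v => x - v * s) (-s) v := by
          simpa using ((hasDerivAt_id v).mul_const s).const_sub x
        exact (hGH (x - v * s)).comp v this
      · exact Continuous.intervalIntegrable (by fun_prop) _ _
    rw [← h1, intervalIntegral.integral_mul_const, abs_mul, abs_neg, mul_comm]
    gcongr
    exact abs_integral_le_integral_abs zero_le_one
  set Φ : ℝ → ℝ := fun x => H x ^ 2 * M x with hΦ
  set Ψ : ℝ → ℝ := fun x => G x ^ 2 * M x with hΨ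
  have hΦc : Continuous Φ := by fun_prop
  have hΨc : Continuous Ψ := by fun_prop
  have hΦT : Function.Periodic Φ T := fun x => by simp only [hΦ, hHT x, hMT x]
  have hΨT : Function.Periodic Ψ T := fun x => by simp only [hΨ, hGT x, hMT x]
  have hprod : ∀ a b : ℝ, |a| * |b| ≤ (a ^ 2 + b ^ 2) / 2 := fun a b => by
    nlinarith [sq_nonneg (|a| - |b|), sq_abs a, sq_abs b]
  have hpt : ∀ x, |H x * (G (x - s) * M (x - s) - G x * M x) * q x| ≤
      B * (|s| * ∫ v in (0 : ℝ)..1, (Φ x + E * Φ (x - v * s)) / 2)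
        + B * (K * |s| * ((E * Φ x + Ψ (x - s)) / 2)) := by
    intro x
    have hxs : |x - s - x| = |s| := by rw [show x - s - x = -s by ring, abs_neg]
    have t1 : |H x * (G (x - s) - G x) * M x| ≤
        |s| * ∫ v in (0 : ℝ)..1, (Φ x + E * Φ (x - v * s)) / 2 := by
      rw [abs_mul, abs_mul, abs_of_nonneg (hM0 x)]
      calc |H x| * |G (x - s) - G x| * M x
          ≤ |H x| * (|s| * ∫ v in (0 : ℝ)..1, |H (x - v * s)|) * M x := by
            have := hM0 x
            gcongr
            exact hdiff x
        _ = |s| * ∫ v in (0 : ℝ)..1, |H x| * M x * |H (x - v * s)| := by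
            rw [intervalIntegral.integral_const_mul]; ring
        _ ≤ _ := by
            gcongr
            refine integral_mono_on zero_le_one (Continuous.intervalIntegrable (by fun_prop) _ _)
              (Continuous.intervalIntegrable (by fun_prop) _ _) fun v hv => ?_
            have hME' : M x ≤ E * M (x - v * s) := by
              refine hME _ _ (le_trans ?_ hs)
              rw [show x - (x - v * s) = v * s by ring, abs_mul, abs_of_nonneg hv.1]
              exact mul_le_of_le_one_left (abs_nonneg s) hv.2
            calc |H x| * M x * |H (x - v * s)| = |H x| * |H (x - v * s)| * M x := by ring
              _ ≤ (H x ^ 2 + H (x - v * s) ^ 2) / 2 * M x :=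
                mul_le_mul_of_nonneg_right (hprod _ _) (hM0 x)
              _ = (H x ^ 2 * M x + H (x - v * s) ^ 2 * M x) / 2 := by ring
              _ ≤ (H x ^ 2 * M x + H (x - v * s) ^ 2 * (E * M (x - v * s))) / 2 := by gcongr
              _ = _ := by simp only [hΦ]; ring
    have t2 : |H x * G (x - s) * (M (x - s) - M x)| ≤ K * |s| * ((E * Φ x + Ψ (x - s)) / 2) := by
      have h1 := hMK (x - s) x (by rwa [hxs])
      rw [hxs] at h1
      have h2 := hME (x - s) x (by rwa [hxs])
      rw [abs_mul, abs_mul]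
      calc |H x| * |G (x - s)| * |M (x - s) - M x|
          ≤ (H x ^ 2 + G (x - s) ^ 2) / 2 * (K * |s| * M (x - s)) := by
            have := hM0 (x - s)
            gcongr
            exact hprod _ _
        _ = K * |s| * ((H x ^ 2 * M (x - s) + G (x - s) ^ 2 * M (x - s)) / 2) := by ring
        _ ≤ K * |s| * ((H x ^ 2 * (E * M x) + G (x - s) ^ 2 * M (x - s)) / 2) := by gcongr
        _ = _ := by simp only [hΦ, hΨ]; ring
    have hsplit : H x * (G (x - s) * M (x - s) - G x * M x) * q x =
      (H x * (G (x - s) - G x) * M x + H x * G (x - s) * (M (x - s) - M x)) * q x := by ring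
    rw [hsplit, abs_mul, ← mul_add, mul_comm B]
    have := abs_add_le (H x * (G (x - s) - G x) * M x) (H x * G (x - s) * (M (x - s) - M x))
    exact mul_le_mul (by linarith) (hqB x) (abs_nonneg _)
      ((abs_nonneg _).trans (this.trans (add_le_add t1 t2)))
  have hjc : Continuous fun z : ℝ × ℝ => (Φ z.1 + E * Φ (z.1 - z.2 * s)) / 2 := by fun_prop
  have hic : Continuous fun x => ∫ v in (0 : ℝ)..1, (Φ x + E * Φ (x - v * s)) / 2 :=
    continuous_parametric_intervalIntegral_of_continuous' hjc 0 1
  refine (abs_integral_le_integral_of_abs_le hT (by fun_prop) hpt).trans ?_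
  have hsΦ : ∀ w, ∫ x in (0 : ℝ)..T, Φ (x - w) = ∫ x in (0 : ℝ)..T, Φ x := fun w => by
    simpa [sub_eq_add_neg] using integral_comp_add_of_periodic hΦT (-w)
  have hsΨ : ∀ w, ∫ x in (0 : ℝ)..T, Ψ (x - w) = ∫ x in (0 : ℝ)..T, Ψ x := fun w => by
    simpa [sub_eq_add_neg] using integral_comp_add_of_periodic hΨT (-w)
  have i1 : ∫ x in (0 : ℝ)..T, ∫ v in (0 : ℝ)..1, (Φ x + E * Φ (x - v * s)) / 2
      = (1 + E) / 2 * ∫ x in (0 : ℝ)..T, Φ x := by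
    rw [integral_swap_of_continuous hjc]
    have : ∀ v, ∫ x in (0 : ℝ)..T, (Φ x + E * Φ (x - v * s)) / 2
        = (1 + E) / 2 * ∫ x in (0 : ℝ)..T, Φ x := by
      intro v
      rw [intervalIntegral.integral_div, integral_add (hΦc.intervalIntegrable _ _)
        (Continuous.intervalIntegrable (by fun_prop) _ _), intervalIntegral.integral_const_mul, hsΦ]
      ring
    simp [this]
  have i2 : ∫ x in (0 : ℝ)..T, (E * Φ x + Ψ (x - s)) / 2
      = (E * (∫ x in (0 : ℝ)..T, Φ x) + ∫ x in (0 : ℝ)..T, Ψ x) / 2 := by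
    rw [intervalIntegral.integral_div, integral_add (Continuous.intervalIntegrable (by fun_prop) _ _)
        (Continuous.intervalIntegrable (by fun_prop) _ _), intervalIntegral.integral_const_mul, hsΨ]
  rw [integral_add (Continuous.intervalIntegrable (by fun_prop) _ _)
    (Continuous.intervalIntegrable (by fun_prop) _ _), intervalIntegral.integral_const_mul, intervalIntegral.integral_const_mul,
    intervalIntegral.integral_const_mul, intervalIntegral.integral_const_mul, i1, i2]
  have hΦ0 : 0 ≤ ∫ x in (0 : ℝ)..T, Φ x :=
    integral_nonneg hT fun x _ => mul_nonneg (sq_nonneg _) (hM0 x)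
  have hΨ0 : 0 ≤ ∫ x in (0 : ℝ)..T, Ψ x :=
    integral_nonneg hT fun x _ => mul_nonneg (sq_nonneg _) (hM0 x)
  change _ ≤ B * (1 + E) * (1 + K) * |s| * ((∫ x in (0 : ℝ)..T, Φ x) + ∫ x in (0 : ℝ)..T, Ψ x)
  generalize (∫ x in (0 : ℝ)..T, Φ x) = a at *
  generalize (∫ x in (0 : ℝ)..T, Ψ x) = b at *
  have : B * (1 + E) * (1 + K) * |s| * (a + b) - (B * (|s| * ((1 + E) / 2 * a)) +
      B * (K * |s| * ((E * a + b) / 2))) = B * |s| * ((1 + E) * a / 2 + (1 + E) * b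
        + K * ((1 + E / 2) * a + (1 / 2 + E) * b)) := by ring
  have h2 : 0 ≤ B * |s| * ((1 + E) * a / 2 + (1 + E) * b
        + K * ((1 + E / 2) * a + (1 / 2 + E) * b)) := by positivity
  linarith

end Core

theorem integral_abs_mul_weight_le_energy {G H M : ℝ → ℝ} {T : ℝ} (hT : 0 ≤ T) (hG : Continuous G)
    (hH : Continuous H) (hM : Continuous M) (hM0 : ∀ x, 0 ≤ M x) :
    ∫ x in (0 : ℝ)..T, |H x * (G x * M x)| ≤ energy G H M T / 2 := by
  rw [energy, ← integral_add (Continuous.intervalIntegrable (by fun_prop) _ _)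
    (Continuous.intervalIntegrable (by fun_prop) _ _), ← intervalIntegral.integral_div]
  refine integral_mono_on hT (Continuous.intervalIntegrable (by fun_prop) _ _)
    (Continuous.intervalIntegrable (by fun_prop) _ _) fun x _ => ?_
  rw [abs_mul, abs_mul, abs_of_nonneg (hM0 x)]
  rw [← sq_abs (H x), ← sq_abs (G x)]
  nlinarith [mul_nonneg (sq_nonneg (|H x| - |G x|)) (hM0 x)]

/-- The second-order Taylor remainder of the jump part, tested against `G` in the weight `M`, is
controlled by the weighted energy, using only boundedness of the density `r`. -/
theorem abs_integral_jump_remainder_le {G H M r τ τ' : ℝ → ℝ} {T E K B ε b : ℝ}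
    (hT : 0 ≤ T) (hb : 0 ≤ b) (hGH : ∀ x, HasDerivAt G (H x) x)
    (hH : Continuous H) (hM : Continuous M) (hM0 : ∀ x, 0 ≤ M x)
    (hGT : Function.Periodic G T) (hHT : Function.Periodic H T) (hMT : Function.Periodic M T)
    (hrT : Function.Periodic r T) (hr : Continuous r) (hrB : ∀ x, |r x| ≤ B)
    (hE : 0 ≤ E) (hK : 0 ≤ K) (hε : ε = 1 ∨ ε = -1)
    (hτ : Continuous τ) (hτ0 : ∀ θ, 0 ≤ τ θ) (hτb : ∀ θ ∈ Icc 0 b, τ θ ≤ τ b)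
    (hd : ∀ θ ∈ Ioo 0 b, HasDerivAt τ (τ' θ) θ) (hd0 : ∀ θ ∈ Ioo 0 b, 0 ≤ τ' θ)
    (hME : ∀ x y, |x - y| ≤ τ b → M x ≤ E * M y)
    (hMK : ∀ x y, |x - y| ≤ τ b → |M x - M y| ≤ K * |x - y| * M x) :
    |∫ x in (0 : ℝ)..T, (∫ θ in (0 : ℝ)..b,
        (G (x + ε * τ θ) - G x - ε * τ θ * H x) * r (x + ε * θ)) * (G x * M x)|
      ≤ (b * ((1 + E) * (1 + K)) + 2) * B * τ b ^ 2 * energy G H M T := by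
  have hB : 0 ≤ B := (abs_nonneg _).trans (hrB 0)
  have hG : Continuous G := continuous_iff_continuousAt.2 fun t => (hGH t).continuousAt
  have hεa : |ε| = 1 := by rcases hε with h | h <;> simp [h]
  set N := energy G H M T with hN
  have hN0 : 0 ≤ N := add_nonneg
    (integral_nonneg hT fun x _ => mul_nonneg (sq_nonneg _) (hM0 x))
    (integral_nonneg hT fun x _ => mul_nonneg (sq_nonneg _) (hM0 x))
  set F : ℝ → ℝ → ℝ → ℝ := fun x θ u =>
    ε * τ θ * (H (x + u * (ε * τ θ)) - H x) * r (x + ε * θ) * (G x * M x) with hF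
  have hFc : Continuous fun z : ℝ × ℝ × ℝ => F z.1 z.2.1 z.2.2 := by
    simp only [hF]; fun_prop
  have hFcomp : ∀ {X : Type} [TopologicalSpace X] {f g h : X → ℝ}, Continuous f → Continuous g →
      Continuous h → Continuous fun z => F (f z) (g z) (h z) := fun hf hg hh =>
    hFc.comp (hf.prodMk (hg.prodMk hh))
  have hLHS : ∀ x, (∫ θ in (0 : ℝ)..b,
      (G (x + ε * τ θ) - G x - ε * τ θ * H x) * r (x + ε * θ)) * (G x * M x)
      = ∫ u in (0 : ℝ)..1, ∫ θ in (0 : ℝ)..b, F x θ u := by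
    intro x
    rw [← integral_swap_of_continuous (F := fun θ u => F x θ u)
      (hFcomp continuous_const continuous_fst continuous_snd), ← intervalIntegral.integral_mul_const]
    congr 1
    ext θ
    have h1 : ∫ u in (0 : ℝ)..1, H (x + u * (ε * τ θ)) * (ε * τ θ) = G (x + ε * τ θ) - G x := by
      rw [integral_eq_sub_of_hasDerivAt (f := fun u => G (x + u * (ε * τ θ)))
        (f' := fun u => H (x + u * (ε * τ θ)) * (ε * τ θ))]
      · simp
      · intro v _
        have : HasDerivAt (fun v => x + v * (ε * τ θ)) (ε * τ θ) v := by
          simpa using ((hasDerivAt_id v).mul_const (ε * τ θ)).const_add x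
        exact (hGH _).comp v this
      · exact Continuous.intervalIntegrable (by fun_prop) _ _
    have h2 : ∀ u, F x θ u = (H (x + u * (ε * τ θ)) * (ε * τ θ) - ε * τ θ * H x)
        * (r (x + ε * θ) * (G x * M x)) := fun u => by simp only [hF]; ring
    simp only [h2]
    rw [intervalIntegral.integral_mul_const, integral_sub
      (Continuous.intervalIntegrable (by fun_prop) _ _) (by simp), h1]
    simp
    ring
  simp only [hLHS]
  have hFθ : Continuous fun z : ℝ × ℝ => ∫ θ in (0 : ℝ)..b, F z.1 θ z.2 :=
    continuous_parametric_intervalIntegral_of_continuous'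
      (hFcomp (continuous_fst.comp continuous_fst) continuous_snd
        (continuous_snd.comp continuous_fst)) 0 b
  rw [integral_swap_of_continuous hFθ]
  have key : ∀ u ∈ uIoc (0 : ℝ) 1, ‖∫ x in (0 : ℝ)..T, ∫ θ in (0 : ℝ)..b, F x θ u‖
      ≤ (b * ((1 + E) * (1 + K)) + 2) * B * τ b ^ 2 * N := by
    intro u hu
    rw [uIoc_of_le zero_le_one] at hu
    rw [integral_swap_of_continuous (F := fun x θ => F x θ u)
      (hFcomp continuous_fst continuous_snd continuous_const)]
    set I₁ : ℝ → ℝ := fun θ => ∫ x in (0 : ℝ)..T,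
      H x * (G (x - u * (ε * τ θ)) * M (x - u * (ε * τ θ)) - G x * M x)
        * r (x + ε * θ - u * ε * τ θ) with hI₁
    have hI₁c : Continuous I₁ := continuous_parametric_intervalIntegral_of_continuous'
      (by unfold Function.uncurry; fun_prop) 0 T
    set D : ℝ → ℝ → ℝ := fun x θ =>
      τ θ * (r (x + ε * θ - u * ε * τ θ) - r (x + ε * θ)) with hD
    have hDc : Continuous fun z : ℝ × ℝ => D z.1 z.2 := by simp only [hD]; fun_prop
    have hsplit : ∀ θ, ∫ x in (0 : ℝ)..T, F x θ u =
        ε * τ θ * I₁ θ + ε * ∫ x in (0 : ℝ)..T, H x * (G x * M x) * D x θ := by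
      intro θ
      set s := u * (ε * τ θ) with hs
      -- Translation by `s` over a full period removes the shift from `H` and places it on `r`, `G`
      -- and `M`.
      have hper : Function.Periodic
          (fun x => H x * (r (x + ε * θ - s) * (G (x - s) * M (x - s)))) T := by
        intro x
        have e1 : x + T + ε * θ - s = x + ε * θ - s + T := by ring
        have e2 : x + T - s = x - s + T := by ring
        simp only [e1, e2, hHT x, hrT _, hGT _, hMT _]
      have h1 := integral_comp_add_of_periodic hper s
      have h2 : ∀ x, F x θ u = ε * τ θ * (H (x + s) * (r (x + s + ε * θ - s)
          * (G (x + s - s) * M (x + s - s))) - H x * (r (x + ε * θ) * (G x * M x))) := by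
        intro x
        have e1 : x + s + ε * θ - s = x + ε * θ := by ring
        simp only [hF, e1, add_sub_cancel_right, ← hs]
        ring
      simp only [h2]
      rw [intervalIntegral.integral_const_mul, integral_sub
        (Continuous.intervalIntegrable (by fun_prop) _ _)
        (Continuous.intervalIntegrable (by fun_prop) _ _), h1, ← integral_sub
        (Continuous.intervalIntegrable (by fun_prop) _ _)
        (Continuous.intervalIntegrable (by fun_prop) _ _), hI₁,
        ← intervalIntegral.integral_const_mul, ← intervalIntegral.integral_const_mul,
        ← intervalIntegral.integral_const_mul, ← integral_add
        (Continuous.intervalIntegrable (by fun_prop) _ _)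
        (Continuous.intervalIntegrable (by fun_prop) _ _)]
      congr 1
      ext x
      have e1 : x + ε * θ - u * ε * τ θ = x + ε * θ - s := by rw [hs]; ring
      simp only [hD, e1, ← hs]
      ring
    simp only [hsplit]
    have hHD : Continuous fun z : ℝ × ℝ => H z.1 * (G z.1 * M z.1) * D z.1 z.2 := by fun_prop
    have hI₂c : Continuous fun θ => ∫ x in (0 : ℝ)..T, H x * (G x * M x) * D x θ :=
      continuous_parametric_intervalIntegral_of_continuous'
        (f := fun θ x => H x * (G x * M x) * D x θ) (hHD.comp (continuous_snd.prodMk continuous_fst)) 0 T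
    rw [integral_add (Continuous.intervalIntegrable (by fun_prop) _ _)
      (Continuous.intervalIntegrable (by fun_prop) _ _), intervalIntegral.integral_const_mul]
    have b1 : ‖∫ θ in (0 : ℝ)..b, ε * τ θ * I₁ θ‖
        ≤ (τ b * (B * (1 + E) * (1 + K) * τ b * N)) * |b - 0| := by
      refine norm_integral_le_of_norm_le_const fun θ hθ => ?_
      rw [uIoc_of_le hb] at hθ
      have hθ' := hτb θ (Ioc_subset_Icc_self hθ)
      have hs : |u * (ε * τ θ)| ≤ τ b := by
        rw [abs_mul, abs_mul, hεa, one_mul, abs_of_nonneg hu.1.le, abs_of_nonneg (hτ0 θ)]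
        exact (mul_le_of_le_one_left (hτ0 θ) hu.2).trans hθ'
      have := abs_integral_mul_shift_weight_le hT hGH hH hM hM0 hGT hHT hMT hE hK hME hMK
        (q := fun x => r (x + ε * θ - u * ε * τ θ)) (fun x => hrB _) hs
      rw [Real.norm_eq_abs, abs_mul, abs_mul, hεa, one_mul, abs_of_nonneg (hτ0 θ)]
      have h0 := hτ0 θ
      refine mul_le_mul hθ' (this.trans ?_) (abs_nonneg _) (h0.trans hθ')
      gcongr
    -- With the `θ`-integral innermost, the factor `H G M` comes out and the oscillation bound for
    -- `r` applies at each fixed `x`.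
    have b2 : |∫ θ in (0 : ℝ)..b, ∫ x in (0 : ℝ)..T, H x * (G x * M x) * D x θ|
        ≤ 3 * B * τ b ^ 2 * (N / 2) := by
      rw [← integral_swap_of_continuous (F := fun x θ => H x * (G x * M x) * D x θ) hHD]
      refine (abs_integral_le_integral_of_abs_le hT
        (g := fun x => 3 * B * τ b ^ 2 * |H x * (G x * M x)|) (by fun_prop) fun x => ?_).trans ?_
      · rw [intervalIntegral.integral_const_mul, abs_mul, mul_comm]
        gcongr
        exact abs_integral_mul_shift_sub_le hb hr hrB hε hu.1.le hu.2 hτ.continuousOn (hτ0 0)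
          hd hd0 x
      · rw [intervalIntegral.integral_const_mul]
        gcongr
        exact integral_abs_mul_weight_le_energy hT hG hH hM hM0
    refine (norm_add_le _ _).trans ?_
    rw [norm_mul, Real.norm_eq_abs ε, hεa, one_mul]
    refine (add_le_add b1 b2).trans ?_
    rw [sub_zero, abs_of_nonneg hb]
    have : 0 ≤ B * τ b ^ 2 * N := by positivity
    nlinarith
  simpa using norm_integral_le_of_norm_le_const key

/-! ### One-sided moments and the potential on the line. -/

/-- The integral of `φ θ`, `0 < θ < π`, against the density `r` seen from `x` in direction `ε`. -/
noncomputable def sideMoment (r φ : ℝ → ℝ) (ε x : ℝ) : ℝ :=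
  ∫ θ in (0 : ℝ)..Real.pi, φ θ * r (x + ε * θ)

/-- The contribution of the direction `ε` to the jump part of the generator, on the line. -/
noncomputable def sideJump (r τ G : ℝ → ℝ) (ε x : ℝ) : ℝ :=
  ∫ θ in (0 : ℝ)..Real.pi, (G (x + ε * τ θ) - G x) * r (x + ε * θ)

/-- The potential of the density `r`, lifted to the line. -/
noncomputable def linePotential (r : ℝ → ℝ) (p x : ℝ) : ℝ :=
  (2 * Real.pi)⁻¹ * (sideMoment r (fun θ => |θ| ^ p) 1 x + sideMoment r (fun θ => |θ| ^ p) (-1) x)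

/-- The derivative of `linePotential`. -/
noncomputable def linePotentialDeriv (r : ℝ → ℝ) (p x : ℝ) : ℝ :=
  (2 * Real.pi)⁻¹ * (p * (sideMoment r (fun θ => |θ| ^ (p - 1)) (-1) x
    - sideMoment r (fun θ => |θ| ^ (p - 1)) 1 x))

theorem continuous_abs_rpow {q : ℝ} (hq : 0 ≤ q) : Continuous fun θ : ℝ => |θ| ^ q :=
  (Real.continuous_rpow_const hq).comp continuous_abs

theorem continuous_sideMoment {r φ : ℝ → ℝ} (hr : Continuous r) (hφ : Continuous φ) (ε : ℝ) :
    Continuous (sideMoment r φ ε) :=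
  continuous_parametric_intervalIntegral_of_continuous' (by unfold Function.uncurry; fun_prop) _ _

theorem continuous_sideJump {r τ G : ℝ → ℝ} (hr : Continuous r) (hτ : Continuous τ)
    (hG : Continuous G) (ε : ℝ) : Continuous (sideJump r τ G ε) :=
  continuous_parametric_intervalIntegral_of_continuous' (by unfold Function.uncurry; fun_prop) _ _

theorem sideMoment_periodic {r : ℝ → ℝ} {T : ℝ} (hr : Function.Periodic r T) (φ : ℝ → ℝ) (ε : ℝ) :
    Function.Periodic (sideMoment r φ ε) T := fun x => by
  unfold sideMoment
  congr 1
  ext θ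
  rw [add_right_comm, hr]

theorem hasDerivAt_abs_rpow {θ : ℝ} (hθ : 0 < θ) (q : ℝ) :
    HasDerivAt (fun θ : ℝ => |θ| ^ q) (q * |θ| ^ (q - 1)) θ := by
  have h := Real.hasDerivAt_rpow_const (x := θ) (p := q) (Or.inl hθ.ne')
  rw [abs_of_pos hθ]
  refine h.congr_of_eventuallyEq ?_
  filter_upwards [lt_mem_nhds hθ] with s hs
  rw [abs_of_pos hs]

/-- Since `r` need not be differentiable, integration by parts in `θ` first replaces it by its
antiderivative `P`, which can be differentiated under the integral. -/
theorem hasDerivAt_sideMoment {r φ φ' : ℝ → ℝ} {B ε : ℝ} (hr : Continuous r)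
    (hrB : ∀ x, |r x| ≤ B) (hε : ε = 1 ∨ ε = -1) (hφ : Continuous φ) (hφ' : Continuous φ')
    (hd : ∀ θ, 0 < θ → HasDerivAt φ (φ' θ) θ) (x : ℝ) :
    HasDerivAt (sideMoment r φ ε) (ε * (φ Real.pi * r (x + ε * Real.pi) - φ 0 * r x
      - sideMoment r φ' ε x)) x := by
  have hε2 : ε * ε = 1 := by rcases hε with h | h <;> simp [h]
  set P : ℝ → ℝ := fun t => ∫ s in (0 : ℝ)..t, r s with hP
  have hPd : ∀ t, HasDerivAt P (r t) t := fun t => hr.integral_hasStrictDerivAt 0 t |>.hasDerivAt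
  have hPc : Continuous P := continuous_iff_continuousAt.2 fun t => (hPd t).continuousAt
  have hibp : sideMoment r φ ε = fun t => ε * (φ Real.pi * P (t + ε * Real.pi) - φ 0 * P t
      - ∫ θ in (0 : ℝ)..Real.pi, φ' θ * P (t + ε * θ)) := by
    ext t
    have h := integral_eq_sub_of_hasDerivAt_of_le (f := fun θ => φ θ * P (t + ε * θ))
      (f' := fun θ => φ' θ * P (t + ε * θ) + ε * (φ θ * r (t + ε * θ))) Real.pi_pos.le
      (by fun_prop) (by
        intro θ hθ
        have h1 : HasDerivAt (fun θ => t + ε * θ) ε θ := by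
          simpa using ((hasDerivAt_id θ).const_mul ε).const_add t
        refine HasDerivAt.congr_deriv ((hd θ hθ.1).mul ((hPd _).comp θ h1)) ?_
        ring) (Continuous.intervalIntegrable (by fun_prop) _ _)
    rw [integral_add (Continuous.intervalIntegrable (by fun_prop) _ _)
      (Continuous.intervalIntegrable (by fun_prop) _ _), intervalIntegral.integral_const_mul] at h
    simp only [mul_zero, add_zero] at h
    rw [sideMoment]
    linear_combination ε * h - (∫ θ in (0 : ℝ)..Real.pi, φ θ * r (t + ε * θ)) * hε2
  rw [hibp]
  have hint : HasDerivAt (fun t => ∫ θ in (0 : ℝ)..Real.pi, φ' θ * P (t + ε * θ))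
      (sideMoment r φ' ε x) x := by
    refine (hasDerivAt_integral_of_dominated_loc_of_deriv_le (s := univ) Filter.univ_mem
      (F' := fun t θ => φ' θ * r (t + ε * θ)) (bound := fun θ => |φ' θ| * B)
      (Filter.Eventually.of_forall fun t => Continuous.aestronglyMeasurable (by fun_prop))
      (Continuous.intervalIntegrable (by fun_prop) _ _)
      (Continuous.aestronglyMeasurable (by fun_prop))
      (Filter.Eventually.of_forall fun θ _ t _ => ?_)
      (Continuous.intervalIntegrable (by fun_prop) _ _)
      (Filter.Eventually.of_forall fun θ _ t _ => ?_)).2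
    · rw [Real.norm_eq_abs, abs_mul]
      exact mul_le_mul_of_nonneg_left (hrB _) (abs_nonneg _)
    · exact ((hPd _).comp_add_const t (ε * θ)).const_mul _
  exact (((((hPd _).comp_add_const x (ε * Real.pi)).const_mul _).sub
    ((hPd x).const_mul _)).sub hint).const_mul ε

section Potential

variable {r : ℝ → ℝ} {B p : ℝ}

/-- The boundary terms of the two directions cancel: at `θ = π` because `x + π` and `x - π` are the
same point modulo the period, at `θ = 0` because of the opposite signs. -/
theorem hasDerivAt_linePotential (hp : 1 ≤ p) (hr : Continuous r) (hrB : ∀ x, |r x| ≤ B)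
    (hrT : Function.Periodic r (2 * Real.pi)) (x : ℝ) :
    HasDerivAt (linePotential r p) (linePotentialDeriv r p x) x := by
  have hc := continuous_abs_rpow (q := p) (by linarith)
  have hc' : Continuous fun θ : ℝ => p * |θ| ^ (p - 1) :=
    continuous_const.mul (continuous_abs_rpow (by linarith))
  have h := fun ε hε => hasDerivAt_sideMoment (ε := ε) hr hrB hε hc hc'
    (fun θ hθ => hasDerivAt_abs_rpow hθ p) x
  refine HasDerivAt.congr_deriv
    (((h 1 (Or.inl rfl)).add (h (-1) (Or.inr rfl))).const_mul (2 * Real.pi)⁻¹) ?_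
  have e1 : r (x + 1 * Real.pi) = r (x + -1 * Real.pi) := by
    rw [← hrT (x + -1 * Real.pi)]; congr 1; ring
  have e2 : ∀ ε, sideMoment r (fun θ => p * |θ| ^ (p - 1)) ε x
      = p * sideMoment r (fun θ => |θ| ^ (p - 1)) ε x := fun ε => by
    simp only [sideMoment, mul_assoc, intervalIntegral.integral_const_mul]
  rw [e1, e2, e2, linePotentialDeriv]
  ring

theorem abs_sideMoment_le {φ : ℝ → ℝ} {C ε x : ℝ} (hrB : ∀ x, |r x| ≤ B)
    (hφ : ∀ θ ∈ Icc 0 Real.pi, |φ θ| ≤ C) :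
    |sideMoment r φ ε x| ≤ C * B * Real.pi := by
  have h := norm_integral_le_of_norm_le_const (a := 0) (b := Real.pi)
    (f := fun θ => φ θ * r (x + ε * θ)) (C := C * B) fun θ hθ => by
      rw [uIoc_of_le Real.pi_pos.le] at hθ
      have := hφ θ (Ioc_subset_Icc_self hθ)
      rw [norm_mul]
      exact mul_le_mul this (hrB _) (abs_nonneg _) ((abs_nonneg _).trans this)
  rwa [sub_zero, abs_of_pos Real.pi_pos] at h

theorem abs_linePotentialDeriv_le (hp : 1 ≤ p) (hrB : ∀ x, |r x| ≤ B) (x : ℝ) :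
    |linePotentialDeriv r p x| ≤ p * Real.pi ^ (p - 1) * B := by
  have hpi := Real.pi_pos
  have h := fun ε => abs_sideMoment_le (φ := fun θ => |θ| ^ (p - 1)) (ε := ε) (x := x)
    (C := Real.pi ^ (p - 1)) hrB fun θ hθ => by
      rw [abs_of_nonneg (by positivity), abs_of_nonneg hθ.1]
      exact Real.rpow_le_rpow hθ.1 hθ.2 (by linarith)
  rw [linePotentialDeriv, abs_mul, abs_mul, abs_of_pos (by positivity : 0 < (2 * Real.pi)⁻¹),
    abs_of_nonneg (by linarith : 0 ≤ p), inv_mul_le_iff₀ (by positivity)]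
  have h2 := (abs_sub (sideMoment r (fun θ => |θ| ^ (p - 1)) (-1) x)
    (sideMoment r (fun θ => |θ| ^ (p - 1)) 1 x)).trans (add_le_add (h (-1)) (h 1))
  refine (mul_le_mul_of_nonneg_left h2 (by linarith)).trans (le_of_eq ?_)
  ring

theorem linePotential_periodic {T : ℝ} (hrT : Function.Periodic r T) :
    Function.Periodic (linePotential r p) T := fun x => by
  simp only [linePotential, sideMoment_periodic hrT _ _ x]

theorem abs_linePotential_sub_le (hp : 1 ≤ p) (hr : Continuous r) (hrB : ∀ x, |r x| ≤ B)
    (hrT : Function.Periodic r (2 * Real.pi)) (x y : ℝ) :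
    |linePotential r p x - linePotential r p y| ≤ p * Real.pi ^ (p - 1) * B * |x - y| :=
  convex_univ.norm_image_sub_le_of_norm_hasDerivWithin_le
    (fun z _ => (hasDerivAt_linePotential hp hr hrB hrT z).hasDerivWithinAt)
    (fun z _ => abs_linePotentialDeriv_le hp hrB z) (mem_univ y) (mem_univ x)

end Potential

/-! ### The Gibbs weight and the inequality on the line. -/

theorem abs_exp_sub_one_le_mul_exp (z : ℝ) : |Real.exp z - 1| ≤ |z| * Real.exp |z| := by
  have h1 := Real.add_one_le_exp z
  rcases le_total 0 z with hz | hz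
  · rw [abs_of_nonneg hz, abs_of_nonneg (by linarith)]
    have h2 := Real.add_one_le_exp (-z)
    have h3 : Real.exp (-z) * Real.exp z = 1 := by rw [← Real.exp_add]; simp
    nlinarith [Real.exp_pos z]
  · have h4 : Real.exp z ≤ 1 := Real.exp_le_one_iff.2 hz
    rw [abs_of_nonpos hz, abs_of_nonpos (by linarith)]
    nlinarith [Real.one_le_exp (neg_nonneg.2 hz)]

/-- Supplies the constants `E = exp κ` and `K = β L exp κ` of the remainder estimate: over
displacements up to `S` the exponent varies by at most `κ`. -/
theorem exp_neg_mul_le_of_lipschitz {V : ℝ → ℝ} {β L S κ : ℝ} (hβ : 0 ≤ β)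
    (hV : ∀ x y, |V x - V y| ≤ L * |x - y|) (hL : 0 ≤ L) (hκ : β * L * S ≤ κ) (x y : ℝ)
    (hxy : |x - y| ≤ S) :
    Real.exp (-β * V x) ≤ Real.exp κ * Real.exp (-β * V y) ∧
    |Real.exp (-β * V x) - Real.exp (-β * V y)|
      ≤ β * L * Real.exp κ * |x - y| * Real.exp (-β * V x) := by
  have h1 : |β * (V x - V y)| ≤ β * L * |x - y| := by
    rw [abs_mul, abs_of_nonneg hβ, mul_assoc]
    exact mul_le_mul_of_nonneg_left (hV x y) hβ
  have h2 : |β * (V x - V y)| ≤ κ :=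
    h1.trans ((mul_le_mul_of_nonneg_left hxy (by positivity)).trans hκ)
  constructor
  · rw [← Real.exp_add, Real.exp_le_exp]
    linarith [(abs_le.1 h2).1]
  · have h3 : Real.exp (-β * V x) - Real.exp (-β * V y)
        = -(Real.exp (-β * V x) * (Real.exp (β * (V x - V y)) - 1)) := by
      rw [mul_sub, ← Real.exp_add, show -β * V x + β * (V x - V y) = -β * V y by ring]
      ring
    rw [h3, abs_neg, abs_mul, abs_of_pos (Real.exp_pos _), mul_comm]
    gcongr
    calc _ ≤ |β * (V x - V y)| * Real.exp |β * (V x - V y)| := abs_exp_sub_one_le_mul_exp _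
      _ ≤ β * L * |x - y| * Real.exp κ := by gcongr
      _ = _ := by ring

/-- The first-order part of the jump operator cancels the drift created by integrating the Laplacian
by parts, leaving only the Taylor remainder. -/
theorem integral_line_generator_le {p B : ℝ} (hp : 1 ≤ p) (hB : 0 < B) :
    ∃ C : ℝ, 0 < C ∧ ∀ r : ℝ → ℝ, Continuous r → (∀ x, |r x| ≤ B) →
      Function.Periodic r (2 * Real.pi) → ∀ α β : ℝ, 0 < α → 1 ≤ β → α * β ^ 2 ≤ 1 / 4 →
      ∀ G H H₂ : ℝ → ℝ, (∀ x, HasDerivAt G (H x) x) → (∀ x, HasDerivAt H (H₂ x) x) →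
      Continuous H₂ → Function.Periodic G (2 * Real.pi) → Function.Periodic H (2 * Real.pi) →
      ∫ x in (0 : ℝ)..(2 * Real.pi), (1 / 2 * H₂ x + 1 / α * ((2 * Real.pi)⁻¹ *
          (sideJump r (fun θ => p / 2 * β * α * |θ| ^ (p - 1)) G 1 x
            + sideJump r (fun θ => p / 2 * β * α * |θ| ^ (p - 1)) G (-1) x)))
          * (G x * Real.exp (-β * linePotential r p x))
        ≤ -(1 / 2) * (∫ x in (0 : ℝ)..(2 * Real.pi), H x ^ 2 * Real.exp (-β * linePotential r p x))
          + C * α * β ^ 3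
            * energy G H (fun x => Real.exp (-β * linePotential r p x)) (2 * Real.pi) := by
  have hpi := Real.pi_pos
  set D : ℝ := p * Real.pi ^ (p - 1) with hD
  have hD0 : 0 < D := by positivity
  set κ : ℝ := D ^ 2 * B / 8 with hκ
  set E : ℝ := Real.exp κ with hE
  have hE0 : 0 < E := Real.exp_pos _
  -- `D² / 4` comes from `τ(π)² = (D β α / 2)²`, and `π⁻¹` from two directions times `(2π)⁻¹`.
  refine ⟨Real.pi⁻¹ * ((Real.pi * ((1 + E) * (1 + D * B * E)) + 2) * B * (D ^ 2 / 4)),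
    by positivity, ?_⟩
  intro r hr hrB hrT α β hα hβ hαβ G H H₂ hGH hHH hH₂ hGT hHT
  have hβ0 : 0 < β := by linarith
  set T : ℝ := 2 * Real.pi with hT
  set τ : ℝ → ℝ := fun θ => p / 2 * β * α * |θ| ^ (p - 1) with hτ
  set V := linePotential r p with hV
  set V' := linePotentialDeriv r p with hV'
  set M : ℝ → ℝ := fun x => Real.exp (-β * V x) with hM
  have hG : Continuous G := continuous_iff_continuousAt.2 fun t => (hGH t).continuousAt
  have hH : Continuous H := continuous_iff_continuousAt.2 fun t => (hHH t).continuousAt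
  have hVd : ∀ x, HasDerivAt V (V' x) x := hasDerivAt_linePotential hp hr hrB hrT
  have hVc : Continuous V := continuous_iff_continuousAt.2 fun t => (hVd t).continuousAt
  have hpow : Continuous fun θ : ℝ => |θ| ^ (p - 1) := continuous_abs_rpow (by linarith)
  have hτc : Continuous τ := continuous_const.mul hpow
  have hmc := fun ε => continuous_sideMoment hr hpow ε
  have hmτc := fun ε => continuous_sideMoment hr hτc ε
  have hV'c : Continuous V' := by
    have h1 := hmc 1
    have h2 := hmc (-1)
    simp only [hV']
    unfold linePotentialDeriv
    fun_prop
  have hMc : Continuous M := by fun_prop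
  have hMT : Function.Periodic M T := fun x => by
    simp only [hM, hV, linePotential_periodic hrT x]
  have hτπ : τ Real.pi = D / 2 * β * α := by
    simp only [hτ, hD, abs_of_pos hpi]; ring
  have hjc := fun ε => continuous_sideJump hr hτc hG ε
  -- Here `β · D B · τ(π) = D² B α β² / 2 ≤ D² B / 8 = κ`; this is where smallness of `α β²` makes
  -- `E` independent of `α` and `β`.
  have hlip := exp_neg_mul_le_of_lipschitz (V := V) (β := β) (L := D * B) (S := τ Real.pi) (κ := κ)
    hβ0.le (abs_linePotential_sub_le hp hr hrB hrT) (by positivity) (by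
      rw [hτπ, hκ]
      have : 0 ≤ D ^ 2 * B / 2 := by positivity
      nlinarith)
  have hrem := fun ε hε => abs_integral_jump_remainder_le (ε := ε) (τ := τ)
    (τ' := fun θ => p / 2 * β * α * ((p - 1) * |θ| ^ (p - 1 - 1))) (b := Real.pi) (T := T)
    (E := E) (K := β * (D * B) * E) (by positivity)
    hpi.le hGH hH hMc (fun x => (Real.exp_pos _).le) hGT hHT hMT hrT hr hrB hE0.le
    (by positivity) hε hτc (fun θ => by simp only [hτ]; positivity)
    (fun θ hθ => by
      simp only [hτ, abs_of_nonneg hθ.1, abs_of_pos hpi]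
      exact mul_le_mul_of_nonneg_left (Real.rpow_le_rpow hθ.1 hθ.2 (by linarith)) (by positivity))
    (fun θ hθ => (hasDerivAt_abs_rpow hθ.1 (p - 1)).const_mul _)
    (fun θ _ => by
      have : 0 ≤ p - 1 := by linarith
      positivity)
    (fun x y h => (hlip x y h).1) (fun x y h => (hlip x y h).2)
  set N := energy G H M T with hN
  have hN0 : 0 ≤ N := add_nonneg
    (integral_nonneg (by positivity) fun x _ => mul_nonneg (sq_nonneg _) (Real.exp_pos _).le)
    (integral_nonneg (by positivity) fun x _ => mul_nonneg (sq_nonneg _) (Real.exp_pos _).le)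
  set R : ℝ → ℝ := fun ε => ∫ x in (0 : ℝ)..T, (∫ θ in (0 : ℝ)..Real.pi,
        (G (x + ε * τ θ) - G x - ε * τ θ * H x) * r (x + ε * θ)) * (G x * M x) with hR
  have hRs : ∀ ε x, ∫ θ in (0 : ℝ)..Real.pi,
      (G (x + ε * τ θ) - G x - ε * τ θ * H x) * r (x + ε * θ)
      = sideJump r τ G ε x - ε * H x * sideMoment r τ ε x := by
    intro ε x
    rw [sideJump, sideMoment, ← intervalIntegral.integral_const_mul, ← integral_sub
      (Continuous.intervalIntegrable (by fun_prop) _ _)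
      (Continuous.intervalIntegrable (by fun_prop) _ _)]
    congr 1
    ext θ
    ring
  have hmτ : ∀ ε x, sideMoment r τ ε x
      = p / 2 * β * α * sideMoment r (fun θ => |θ| ^ (p - 1)) ε x := by
    intro ε x
    simp only [sideMoment, hτ, mul_assoc, intervalIntegral.integral_const_mul]
  have hV'm : ∀ x, (2 * Real.pi)⁻¹ * (sideMoment r τ 1 x - sideMoment r τ (-1) x)
      = -(β * α / 2) * V' x := by
    intro x
    rw [hmτ, hmτ, hV', linePotentialDeriv]
    ring
  have hj1 := hjc 1
  have hj2 := hjc (-1)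
  have hm1 := hmτc 1
  have hm2 := hmτc (-1)
  have hibp : ∫ x in (0 : ℝ)..T, (H₂ x * (G x * M x) + H x ^ 2 * M x
      - β * (V' x * (H x * (G x * M x)))) = 0 := by
    have h := integral_eq_sub_of_hasDerivAt (a := 0) (b := T) (f := fun x => H x * (G x * M x))
      (f' := fun x => H₂ x * (G x * M x) + H x ^ 2 * M x - β * (V' x * (H x * (G x * M x))))
      (fun x _ => by
        have hMd : HasDerivAt M (Real.exp (-β * V x) * (-β * V' x)) x :=
          ((hVd x).const_mul (-β)).exp
        refine HasDerivAt.congr_deriv ((hHH x).mul ((hGH x).mul hMd)) ?_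
        simp only [hM]
        ring) (Continuous.intervalIntegrable (by fun_prop) _ _)
    have e1 := hHT 0
    have e2 := hGT 0
    have e3 := hMT 0
    rw [zero_add] at e1 e2 e3
    rw [h, e1, e2, e3, sub_self]
  have hdecomp : ∫ x in (0 : ℝ)..T, (1 / 2 * H₂ x + 1 / α * (T⁻¹ *
      (sideJump r τ G 1 x + sideJump r τ G (-1) x))) * (G x * M x)
      = -(1 / 2) * (∫ x in (0 : ℝ)..T, H x ^ 2 * M x) + 1 / α * T⁻¹ * (R 1 + R (-1)) := by
    have e : R 1 + R (-1) = ∫ x in (0 : ℝ)..T, ((sideJump r τ G 1 x + sideJump r τ G (-1) x)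
        * (G x * M x) - (sideMoment r τ 1 x - sideMoment r τ (-1) x) * (H x * (G x * M x))) := by
      simp only [hR, hRs]
      rw [← integral_add (Continuous.intervalIntegrable (by fun_prop) _ _)
        (Continuous.intervalIntegrable (by fun_prop) _ _)]
      congr 1
      ext x
      ring
    -- Half of the vanishing integral `hibp` is subtracted; the remaining identity is pointwise, and
    -- `hV'm` cancels the drift against the first-order jump term.
    refine Eq.trans ?_ (show _ + 1 / 2 * (∫ x in (0 : ℝ)..T, (H₂ x * (G x * M x) + H x ^ 2 * M x
      - β * (V' x * (H x * (G x * M x))))) = _ by rw [hibp, mul_zero, add_zero])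
    rw [e, ← intervalIntegral.integral_const_mul, ← intervalIntegral.integral_const_mul,
      ← intervalIntegral.integral_const_mul, ← integral_add
        (Continuous.intervalIntegrable (by fun_prop) _ _)
        (Continuous.intervalIntegrable (by fun_prop) _ _), ← integral_add
        (Continuous.intervalIntegrable (by fun_prop) _ _)
        (Continuous.intervalIntegrable (by fun_prop) _ _)]
    congr 1
    ext x
    have h := hV'm x
    rw [← hT] at h
    have hα1 : 1 / α * α = 1 := by field_simp
    linear_combination (1 / α * (H x * (G x * M x))) * h
      - (β / 2 * V' x * (H x * (G x * M x))) * hα1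
  rw [hdecomp]
  refine add_le_add le_rfl ?_
  have hR1 := (le_abs_self _).trans (hrem 1 (Or.inl rfl))
  have hR2 := (le_abs_self _).trans (hrem (-1) (Or.inr rfl))
  -- As `β ≥ 1`, the dependence on `β` of the weight's Lipschitz constant is absorbed in one factor
  -- `β`, the third power in `β³`.
  have hK : 1 + β * (D * B) * E ≤ β * (1 + D * B * E) := by nlinarith
  set Q : ℝ := (Real.pi * ((1 + E) * (1 + β * (D * B) * E)) + 2) * B * τ Real.pi ^ 2 * N with hQ
  have hQle : Q ≤ β * ((Real.pi * ((1 + E) * (1 + D * B * E)) + 2) * B)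
      * τ Real.pi ^ 2 * N := by
    rw [hQ]
    have : Real.pi * ((1 + E) * (1 + β * (D * B) * E)) + 2
        ≤ β * (Real.pi * ((1 + E) * (1 + D * B * E)) + 2) := by
      have := mul_le_mul_of_nonneg_left hK (by positivity : 0 ≤ Real.pi * (1 + E))
      nlinarith
    rw [← mul_assoc β (_ + _)]
    exact mul_le_mul_of_nonneg_right (mul_le_mul_of_nonneg_right
      (mul_le_mul_of_nonneg_right this hB.le) (sq_nonneg _)) hN0
  calc 1 / α * T⁻¹ * (R 1 + R (-1)) ≤ 1 / α * T⁻¹ * (2 * (β *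
        ((Real.pi * ((1 + E) * (1 + D * B * E)) + 2) * B) * τ Real.pi ^ 2 * N)) := by
        gcongr
        linarith
    _ = _ := by
        rw [hτπ, hT]
        field_simp
        ring

/-! ### Transfer between the circle and the line. -/

theorem continuous_of_continuous_lift {f : Torus → ℝ} (hf : Continuous fun t : ℝ => f (t : Torus)) :
    Continuous f :=
  (QuotientAddGroup.isQuotientMap_mk (AddSubgroup.zmultiples (2 * Real.pi))).continuous_iff.2 hf

theorem lift_periodic (f : Torus → ℝ) : Function.Periodic (fun t : ℝ => f (t : Torus))
    (2 * Real.pi) := fun t => by simp only [AddCircle.coe_add_period]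

theorem integral_lam (f : Torus → ℝ) (t : ℝ) :
    ∫ x, f x ∂lam = (2 * Real.pi)⁻¹ * ∫ s in t..t + 2 * Real.pi, f (s : Torus) := by
  rw [lam, AddCircle.integral_haarAddCircle, AddCircle.intervalIntegral_preimage, smul_eq_mul]

theorem angle_eq_of_sub_eq {x y : Torus} {θ : ℝ} (h : y - x = (θ : Torus))
    (hθ : θ ∈ Ioc (-Real.pi) Real.pi) : angle x y = θ := by
  rw [angle, h]
  exact AddCircle.equivIoc_coe_of_mem ⟨hθ.1, by linarith [hθ.2]⟩

theorem dist_eq_of_sub_eq {x y : Torus} {θ : ℝ} (h : y - x = (θ : Torus))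
    (hθ : |θ| ≤ Real.pi) : dist x y = |θ| := by
  rw [dist_comm, dist_eq_norm, h]
  refine (AddCircle.norm_coe_eq_abs_iff (p := 2 * Real.pi) (by positivity)).2 ?_
  rw [abs_of_pos Real.two_pi_pos]
  linarith

theorem dist_le_pi (x y : Torus) : dist x y ≤ Real.pi := by
  have h := AddCircle.norm_le_half_period (2 * Real.pi) (x := x - y) (by positivity)
  rw [abs_of_pos Real.two_pi_pos] at h
  rw [dist_eq_norm]
  linarith

/-- The data of `y = t + ε θ` seen from `t`: distance and direction. -/
theorem dist_direction_side {t θ ε : ℝ} (hθ : θ ∈ Ioo 0 Real.pi) (hε : ε = 1 ∨ ε = -1) :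
    dist (t : Torus) ((t + ε * θ : ℝ) : Torus) = |θ| ∧
      direction (t : Torus) ((t + ε * θ : ℝ) : Torus) = ε := by
  have hsub : ((t + ε * θ : ℝ) : Torus) - (t : Torus) = ((ε * θ : ℝ) : Torus) := by
    rw [AddCircle.coe_add, add_sub_cancel_left]
  have habs : |ε * θ| = |θ| := by rcases hε with rfl | rfl <;> simp
  refine ⟨(dist_eq_of_sub_eq hsub ?_).trans habs, ?_⟩
  · rw [habs, abs_of_pos hθ.1]
    exact hθ.2.le
  · have h1 := hθ.1
    have h2 := hθ.2
    rw [direction, angle_eq_of_sub_eq hsub]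
    · rcases hε with rfl | rfl
      · rw [if_pos (by linarith)]
      · rw [if_neg (by linarith)]
    · rcases hε with rfl | rfl <;> constructor <;> linarith

section Density

variable {ν : Measure Torus} {ρ : Torus → ℝ}

theorem integral_withDensity_lam (hρ : Continuous ρ) (hρ0 : ∀ x, 0 ≤ ρ x)
    (hν : ν = lam.withDensity fun x => ENNReal.ofReal (ρ x)) (F : Torus → ℝ) :
    ∫ y, F y ∂ν = ∫ y, ρ y * F y ∂lam := by
  rw [hν, integral_withDensity_eq_integral_toReal_smul (by fun_prop) (by simp)]
  simp only [ENNReal.toReal_ofReal (hρ0 _), smul_eq_mul]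

/-- The circle is cut at the antipode of `t` and split at `t`. Agreement with `K` is asked only on
the open half circles, so the conventions for direction at these two null points are irrelevant. -/
theorem integral_eq_sides (hρ : Continuous ρ) (hρ0 : ∀ x, 0 ≤ ρ x)
    (hν : ν = lam.withDensity fun x => ENNReal.ofReal (ρ x)) (F : Torus → ℝ) (K : ℝ → ℝ → ℝ)
    (t : ℝ) (hK : ∀ ε, Continuous (K ε))
    (hF : ∀ ε, (ε = 1 ∨ ε = -1) → ∀ θ ∈ Ioo 0 Real.pi, F ((t + ε * θ : ℝ) : Torus) = K ε θ) :
    ∫ y, F y ∂ν = (2 * Real.pi)⁻¹ *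
      ((∫ θ in (0 : ℝ)..Real.pi, K 1 θ * ρ ((t + 1 * θ : ℝ) : Torus))
        + ∫ θ in (0 : ℝ)..Real.pi, K (-1) θ * ρ ((t + -1 * θ : ℝ) : Torus)) := by
  have hπ := Real.pi_pos
  have hr : Continuous fun s : ℝ => ρ (s : Torus) := hρ.comp (AddCircle.continuous_mk' _)
  rw [integral_withDensity_lam hρ hρ0 hν, integral_lam _ (t + -Real.pi),
    show t + -Real.pi + 2 * Real.pi = t + Real.pi by ring,
    ← intervalIntegral.integral_comp_add_left (fun s => ρ (s : Torus) * F (s : Torus))]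
  congr 1
  have hae : ∀ ε, (ε = 1 ∨ ε = -1) → ∀ θ ∈ Ioo 0 Real.pi,
      K ε θ * ρ ((t + ε * θ : ℝ) : Torus)
      = ρ ((t + ε * θ : ℝ) : Torus) * F ((t + ε * θ : ℝ) : Torus) :=
    fun ε hε θ hθ => by rw [hF ε hε θ hθ, mul_comm]
  have hcont : ∀ ε, Continuous fun θ : ℝ => K ε θ * ρ ((t + ε * θ : ℝ) : Torus) := fun ε =>
    (hK ε).mul (hr.comp (by fun_prop : Continuous fun θ : ℝ => t + ε * θ))
  have hInt : ∀ ε, (ε = 1 ∨ ε = -1) → IntervalIntegrable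
      (fun θ : ℝ => ρ ((t + ε * θ : ℝ) : Torus) * F ((t + ε * θ : ℝ) : Torus))
      volume 0 Real.pi := fun ε hε =>
    ((hcont ε).intervalIntegrable 0 Real.pi).congr_uIoo (by
      rw [uIoo_of_le hπ.le]
      exact fun θ hθ => hae ε hε θ hθ)
  have hEq : ∀ ε, (ε = 1 ∨ ε = -1) →
      ∫ θ in (0 : ℝ)..Real.pi, K ε θ * ρ ((t + ε * θ : ℝ) : Torus)
      = ∫ θ in (0 : ℝ)..Real.pi,
        ρ ((t + ε * θ : ℝ) : Torus) * F ((t + ε * θ : ℝ) : Torus) := by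
    intro ε hε
    apply intervalIntegral.integral_congr_ae
    filter_upwards [Measure.ae_ne volume Real.pi] with θ hθπ hθ
    rw [uIoc_of_le hπ.le] at hθ
    exact hae ε hε θ ⟨hθ.1, lt_of_le_of_ne hθ.2 hθπ⟩
  have i1 := hInt 1 (Or.inl rfl)
  have i2 := hInt (-1) (Or.inr rfl)
  have e2 : ∫ θ in (0 : ℝ)..Real.pi,
      ρ ((t + -1 * θ : ℝ) : Torus) * F ((t + -1 * θ : ℝ) : Torus)
      = ∫ θ in -Real.pi..0, ρ ((t + θ : ℝ) : Torus) * F ((t + θ : ℝ) : Torus) := by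
    have h := intervalIntegral.integral_comp_neg (a := 0) (b := Real.pi)
      (fun θ : ℝ => ρ ((t + θ : ℝ) : Torus) * F ((t + θ : ℝ) : Torus))
    simpa only [neg_one_mul, neg_zero] using h
  rw [hEq 1 (Or.inl rfl), hEq (-1) (Or.inr rfl), e2]
  simp only [one_mul] at i1 ⊢
  have i3 : IntervalIntegrable (fun θ : ℝ => ρ ((t + θ : ℝ) : Torus) * F ((t + θ : ℝ) : Torus))
      volume (-Real.pi) 0 := by
    have := (i2.comp_mul_left (c := -1)).symm
    simpa [div_neg] using this
  rw [add_comm, integral_add_adjacent_intervals i3 i1]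

theorem potential_coe {p : ℝ} (hp : 1 ≤ p) (hρ : Continuous ρ) (hρ0 : ∀ x, 0 ≤ ρ x)
    (hν : ν = lam.withDensity fun x => ENNReal.ofReal (ρ x)) (t : ℝ) :
    potential ν p (t : Torus) = linePotential (fun s => ρ (s : Torus)) p t :=
  integral_eq_sides hρ hρ0 hν _ (fun _ θ => |θ| ^ p) t
    (fun _ => continuous_abs_rpow (by linarith))
    fun ε hε θ hθ => by rw [(dist_direction_side hθ hε).1]

theorem integral_jump_coe {p c : ℝ} (hp : 1 ≤ p) (hρ : Continuous ρ) (hρ0 : ∀ x, 0 ≤ ρ x)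
    (hν : ν = lam.withDensity fun x => ENNReal.ofReal (ρ x)) {f : Torus → ℝ}
    (hf : Continuous fun s : ℝ => f (s : Torus)) (t : ℝ) :
    ∫ y, (f (geodesic (t : Torus) y (c * dist (t : Torus) y ^ (p - 1))) - f (t : Torus)) ∂ν
      = (2 * Real.pi)⁻¹ *
        (sideJump (fun s => ρ (s : Torus)) (fun θ => c * |θ| ^ (p - 1))
            (fun s => f (s : Torus)) 1 t
          + sideJump (fun s => ρ (s : Torus)) (fun θ => c * |θ| ^ (p - 1))
            (fun s => f (s : Torus)) (-1) t) := by
  have hpow : Continuous fun θ : ℝ => |θ| ^ (p - 1) := continuous_abs_rpow (by linarith)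
  refine integral_eq_sides hρ hρ0 hν _
    (fun ε θ => f ((t + ε * (c * |θ| ^ (p - 1)) : ℝ) : Torus) - f (t : Torus)) t
    (fun ε => (hf.comp (by fun_prop :
      Continuous fun θ : ℝ => t + ε * (c * |θ| ^ (p - 1)))).sub continuous_const) ?_
  intro ε hε θ hθ
  obtain ⟨h1, h2⟩ := dist_direction_side (t := t) hθ hε
  rw [geodesic, h1, h2, ← AddCircle.coe_add, mul_comm ε]

end Density

/-- On the lift, the natural derivative is the ordinary derivative. -/
theorem circleDeriv_coe (f : Torus → ℝ) (t : ℝ) :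
    circleDeriv f (t : Torus) = deriv (fun s : ℝ => f (s : Torus)) t := by
  simp only [circleDeriv, ← AddCircle.coe_add]
  rw [deriv_comp_const_add (f := fun s : ℝ => f (s : Torus)), add_zero]

theorem circleDeriv_sub_const (f : Torus → ℝ) (c : ℝ) :
    circleDeriv (fun z => f z - c) = circleDeriv f := by
  ext x
  simp only [circleDeriv, deriv_sub_const_fun]

theorem integral_gibbs {ν : Measure Torus} {p β : ℝ} (g : Torus → ℝ) :
    ∫ x, g x ∂(gibbs ν p β) = ((∫ x, Real.exp (-β * potential ν p x) ∂lam)⁻¹ * (2 * Real.pi)⁻¹) *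
      ∫ t in (0 : ℝ)..2 * Real.pi,
        g (t : Torus) * Real.exp (-β * potential ν p (t : Torus)) := by
  rw [gibbs, integral_tilted, mul_assoc]
  have h := integral_lam (fun x => g x * Real.exp (-β * potential ν p x)) 0
  rw [zero_add] at h
  rw [← h, ← MeasureTheory.integral_const_mul]
  congr 1
  ext x
  rw [smul_eq_mul]
  ring

/-! ### Bounds on the density and the conclusion. -/

/-- The density has mean `1` and oscillates by at most `A π^a ≤ A π`. The bound does not depend on
`a`, which makes `c₃` depend on `p` and `A` only. -/
theorem density_le {ν : Measure Torus} [IsProbabilityMeasure ν] {ρ : Torus → ℝ} {A a : ℝ}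
    (hA : 0 ≤ A) (ha : 0 < a) (ha1 : a ≤ 1) (hρ : Continuous ρ) (hρ0 : ∀ x, 0 ≤ ρ x)
    (hν : ν = lam.withDensity fun x => ENNReal.ofReal (ρ x))
    (hH : ∀ x y, |ρ y - ρ x| ≤ A * dist x y ^ a) (x : Torus) : ρ x ≤ 1 + A * Real.pi := by
  have : IsProbabilityMeasure lam := inferInstanceAs (IsProbabilityMeasure AddCircle.haarAddCircle)
  have h1 : ∫ y, ρ y ∂lam = 1 := by
    have := integral_withDensity_lam hρ hρ0 hν (fun _ => 1)
    simpa using this.symm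
  have hpt : ∀ y, ρ x ≤ ρ y + A * Real.pi := by
    intro y
    have h2 : dist y x ^ a ≤ Real.pi := by
      calc dist y x ^ a ≤ Real.pi ^ a := Real.rpow_le_rpow dist_nonneg (dist_le_pi y x) ha.le
        _ ≤ Real.pi ^ (1 : ℝ) := Real.rpow_le_rpow_of_exponent_le
            (by linarith [Real.pi_gt_three]) ha1
        _ = Real.pi := Real.rpow_one _
    have h3 := (le_abs_self _).trans ((hH y x).trans (mul_le_mul_of_nonneg_left h2 hA))
    linarith
  have hi : Integrable ρ lam :=
    hρ.integrable_of_hasCompactSupport (HasCompactSupport.of_compactSpace ρ)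
  have h4 := integral_mono (μ := lam) (integrable_const (ρ x)) (hi.add (integrable_const _)) hpt
  simp only [Pi.add_apply] at h4
  rw [integral_add hi (integrable_const _), h1] at h4
  simpa using h4

theorem continuous_of_hoelder {ρ : Torus → ℝ} {A a : ℝ} (ha : 0 < a)
    (hH : ∀ x y, |ρ y - ρ x| ≤ A * dist x y ^ a) : Continuous ρ := by
  refine continuous_iff_continuousAt.2 fun x => ?_
  rw [ContinuousAt, tendsto_iff_dist_tendsto_zero]
  have hc : Continuous fun y => A * dist x y ^ a :=
    continuous_const.mul ((continuous_const.dist continuous_id).rpow_const fun _ => Or.inr ha.le)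
  have ht := hc.tendsto x
  simp only [dist_self, Real.zero_rpow ha.ne', mul_zero] at ht
  exact squeeze_zero (fun _ => dist_nonneg) (fun y => hH x y) ht

theorem aTilde_le_one (p : ℝ) : aTilde p ≤ 1 := by
  unfold aTilde
  split_ifs with h
  · exact le_rfl
  · push Not at h
    linarith [h.2]

/-- The line inequality multiplied by the normalisation of the Gibbs measure. Nonnegativity of the
Dirichlet integral is recorded because the power of `α` in front of it is weakened afterwards. -/
theorem dirichlet_form_le {p B : ℝ} (hp : 1 ≤ p) (hB : 0 < B) :
    ∃ C : ℝ, 0 < C ∧ ∀ (ν : Measure Torus) (ρ : Torus → ℝ), Continuous ρ → (∀ x, 0 ≤ ρ x) →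
      (∀ x, ρ x ≤ B) → (ν = lam.withDensity fun x => ENNReal.ofReal (ρ x)) →
      ∀ α β : ℝ, 0 < α → 1 ≤ β → α * β ^ 2 ≤ 1 / 4 → ∀ f : Torus → ℝ, IsC2 f →
        Integrable (fun x => generator ν p α β (fun z => f z - 1) x * (f x - 1)) (gibbs ν p β) ∧
        ∫ x, generator ν p α β (fun z => f z - 1) x * (f x - 1) ∂(gibbs ν p β)
          ≤ -(1 / 2) * (∫ x, (circleDeriv f x) ^ 2 ∂(gibbs ν p β))
            + C * α * β ^ 3 * ((∫ x, (circleDeriv f x) ^ 2 ∂(gibbs ν p β))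
              + ∫ x, (f x - 1) ^ 2 ∂(gibbs ν p β)) ∧
        0 ≤ ∫ x, (circleDeriv f x) ^ 2 ∂(gibbs ν p β) := by
  obtain ⟨C, hC, hmain⟩ := integral_line_generator_le hp hB
  refine ⟨C, hC, fun ν ρ hρ hρ0 hρB hν α β hα hβ hαβ f hf => ?_⟩
  have : IsProbabilityMeasure lam := inferInstanceAs (IsProbabilityMeasure AddCircle.haarAddCircle)
  set r : ℝ → ℝ := fun s => ρ (s : Torus) with hrdef
  have hr : Continuous r := hρ.comp (AddCircle.continuous_mk' _)
  have hrB : ∀ x, |r x| ≤ B := fun x => by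
    rw [abs_of_nonneg (hρ0 _)]
    exact hρB _
  have hrT : Function.Periodic r (2 * Real.pi) := lift_periodic ρ
  have hpot : ∀ t : ℝ, potential ν p (t : Torus) = linePotential r p t :=
    potential_coe hp hρ hρ0 hν
  have hVc : Continuous (linePotential r p) :=
    continuous_iff_continuousAt.2 fun t => (hasDerivAt_linePotential hp hr hrB hrT t).continuousAt
  set G : ℝ → ℝ := fun s => f (s : Torus) - 1 with hGdef
  have hGC : ContDiff ℝ 2 G := ContDiff.sub hf contDiff_const
  have hGd : ∀ x, HasDerivAt G (deriv G x) x := fun x =>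
    ((hGC.differentiable (by norm_num)) x).hasDerivAt
  have hHC : ContDiff ℝ 1 (deriv G) := by
    have h2 : ContDiff ℝ (1 + 1) G := by
      rw [one_add_one_eq_two]; exact hGC
    exact (contDiff_succ_iff_deriv.1 h2).2.2
  have hHd : ∀ x, HasDerivAt (deriv G) (deriv (deriv G) x) x := fun x =>
    ((hHC.differentiable (by norm_num)) x).hasDerivAt
  have hH₂ : Continuous (deriv (deriv G)) := hHC.continuous_deriv (by norm_num)
  have hGT : Function.Periodic G (2 * Real.pi) := lift_periodic fun z => f z - 1
  have hcd : ∀ t : ℝ, circleDeriv f (t : Torus) = deriv G t := fun t => by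
    rw [← circleDeriv_sub_const f 1, circleDeriv_coe]
  have hHT : Function.Periodic (deriv G) (2 * Real.pi) := fun t => by
    rw [← hcd, ← hcd, AddCircle.coe_add_period]
  have hcd2 : ∀ t : ℝ, circleDeriv (circleDeriv f) (t : Torus) = deriv (deriv G) t := fun t => by
    rw [circleDeriv_coe]
    simp only [hcd]
  have hpow : Continuous fun θ : ℝ => |θ| ^ (p - 1) := continuous_abs_rpow (by linarith)
  have hgen : ∀ t : ℝ, generator ν p α β (fun z => f z - 1) (t : Torus) =
      1 / 2 * deriv (deriv G) t + 1 / α * ((2 * Real.pi)⁻¹ *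
          (sideJump r (fun θ => p / 2 * β * α * |θ| ^ (p - 1)) G 1 t
            + sideJump r (fun θ => p / 2 * β * α * |θ| ^ (p - 1)) G (-1) t)) := by
    intro t
    rw [generator, circleDeriv_sub_const, hcd2,
      integral_jump_coe hp hρ hρ0 hν (f := fun z => f z - 1) hGC.continuous]
  -- The geodesic is discontinuous across the cut locus, but each one-sided integral has a fixed
  -- direction and is continuous in `x`.
  have hgenc : Continuous fun x => generator ν p α β (fun z => f z - 1) x * (f x - 1) := by
    refine continuous_of_continuous_lift ?_
    simp only [hgen]
    have h1 := continuous_sideJump hr (continuous_const.mul hpow :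
      Continuous fun θ => p / 2 * β * α * |θ| ^ (p - 1)) hGC.continuous 1
    have h2 := continuous_sideJump hr (continuous_const.mul hpow :
      Continuous fun θ => p / 2 * β * α * |θ| ^ (p - 1)) hGC.continuous (-1)
    have h3 : Continuous fun t : ℝ => f (t : Torus) - 1 := hGC.continuous
    fun_prop
  have hexpc : Continuous fun x => Real.exp (-β * potential ν p x) := by
    refine continuous_of_continuous_lift ?_
    simp only [hpot]
    fun_prop
  have hexpi : Integrable (fun x => Real.exp (-β * potential ν p x)) lam :=
    hexpc.integrable_of_hasCompactSupport (HasCompactSupport.of_compactSpace _)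
  have : IsProbabilityMeasure (gibbs ν p β) := isProbabilityMeasure_tilted hexpi
  refine ⟨hgenc.integrable_of_hasCompactSupport (HasCompactSupport.of_compactSpace _), ?_,
    integral_nonneg fun x => sq_nonneg _⟩
  have hline := hmain r hr hrB hrT α β hα hβ hαβ G (deriv G) (deriv (deriv G)) hGd hHd hH₂ hGT hHT
  set k : ℝ := (∫ x, Real.exp (-β * potential ν p x) ∂lam)⁻¹ * (2 * Real.pi)⁻¹ with hk
  have hk0 : 0 ≤ k := by
    have := integral_exp_pos hexpi
    have := Real.pi_pos
    positivity
  rw [integral_gibbs, integral_gibbs, integral_gibbs, ← hk]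
  simp only [hpot, hgen, hcd]
  rw [energy] at hline
  have h := mul_le_mul_of_nonneg_left hline hk0
  simp only [hGdef, mul_assoc] at h ⊢
  refine h.trans (le_of_eq ?_)
  ring

end CircleMeans

theorem mainTheorem6 (p : ℝ) (hp : 1 ≤ p) :
    ∃ σ : ℝ, 0 < σ ∧ σ < 1 / 2 ∧
      ∀ A : ℝ, 0 < A → ∃ c₃ : ℝ, 0 < c₃ ∧
        ∀ (a : ℝ), 0 < a → a ≤ 1 →
        ∀ (ν : Measure Torus) [IsProbabilityMeasure ν] (ρ : Torus → ℝ),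
          (∀ x, 0 ≤ ρ x) →
          ν = lam.withDensity (fun x => ENNReal.ofReal (ρ x)) →
          (∀ x y, |ρ y - ρ x| ≤ A * dist x y ^ a) →
          ∀ α β : ℝ, 0 < α → 1 ≤ β → α * β ^ 2 ≤ σ →
            ∀ f : Torus → ℝ, IsC2 f →
              Integrable (fun x => generator ν p α β (fun z => f z - 1) x * (f x - 1))
                (gibbs ν p β) ∧
              ∫ x, generator ν p α β (fun z => f z - 1) x * (f x - 1) ∂(gibbs ν p β)
                ≤ -(1 / 2 - c₃ * α ^ aTilde p * β ^ 3)
                      * ∫ x, (circleDeriv f x) ^ 2 ∂(gibbs ν p β)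
                  + c₃ * α ^ aTilde p * β ^ 3 * ∫ x, (f x - 1) ^ 2 ∂(gibbs ν p β) := by
  -- Any value below `1/2` would serve: it only has to bound `κ` and force `α ≤ 1`.
  refine ⟨1 / 4, by norm_num, by norm_num, fun A hA => ?_⟩
  have hB : 0 < 1 + A * Real.pi := by positivity
  obtain ⟨C, hC, hmain⟩ := dirichlet_form_le hp hB
  refine ⟨C, hC, fun a ha ha1 ν _ ρ hρ0 hν hH α β hα hβ hαβ f hf => ?_⟩
  have hρ := continuous_of_hoelder ha hH
  obtain ⟨hint, hle, h0⟩ := hmain ν ρ hρ hρ0 (density_le hA.le ha ha1 hρ hρ0 hν hH) hν α β hα hβ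
    hαβ f hf
  refine ⟨hint, hle.trans ?_⟩
  have h1 : 0 ≤ ∫ x, (f x - 1) ^ 2 ∂(gibbs ν p β) := integral_nonneg fun x => sq_nonneg _
  have hα1 : α ≤ 1 := by nlinarith
  have hpow : α ≤ α ^ aTilde p := by
    simpa using Real.rpow_le_rpow_of_exponent_ge hα hα1 (aTilde_le_one p)
  have hcoef : C * α * β ^ 3 ≤ C * α ^ aTilde p * β ^ 3 := by gcongr
  have := mul_le_mul_of_nonneg_right hcoef (add_nonneg h0 h1)
  linarith
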